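/- For $n\ge 1$, $k\ge 2$ and a permutation $w\in S_n$ let $D_k(w)$ be the set of all starting points of $k$-descents of $w$, i.e. of all indices $i\ge 1$ with $i+k-1\le n$ and $w(i)>w(i+1)>\cdots>w(i+k-1)$. For a finite set $I\subseteq\mathbb{Z}^+$ let $d_k(I,n)=|\{w\in S_n : D_k(w)=I\}|$, and let $f_k(n)=d_k(\emptyset,n)$ be the number of permutations in $S_n$ without $k$-descents. Theorem. For every integer $k\ge 3$ and every finite set $I\subseteq\mathbb{Z}^+$ there is a real constant $c_{I,k}$ such that, for $n\in\mathbb{Z}^+$, \[ d_k(I,n)=c_{I,k}\,f_k(n)\,\bigl(1+O(n^{-0.49})\bigr), \] where the implied constant may depend on $k$ and $I$. That is, there is a real sequence $(\varepsilon_n)_{n\ge 1}$ with $\varepsilon_n=O(n^{-0.49})$ as $n\to\infty$ and $d_k(I,n)=c_{I,k}\,f_k(n)\,(1+\varepsilon_n)$ for all $n\ge 1$. (The constant may be $0$; then $d_k(I,n)=0$ for all $n\ge 1$.) -/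

import Mathlib

/-- A permutation of `[n] = {1, …, n}` is an element `w` of `Equiv.Perm (Fin n)`: the element
`a : Fin n` stands for the number `a + 1`, both as an index and as a value.

`IsKDescentStart k w i` says that the (1-based) index `i` is a starting point of a `k`-descent of
`w`: the indices `i, i + 1, …, i + k - 1` all lie in `[n]`, and
`w(i) > w(i + 1) > ⋯ > w(i + k - 1)`.
The two `Fin n` variables `a, b` below range over the consecutive (1-based) indices
`a + 1, b + 1 = a + 2` with `i ≤ a + 1` and `b + 1 ≤ i + k - 1`. -/
def IsKDescentStart (k : ℕ) {n : ℕ} (w : Equiv.Perm (Fin n)) (i : ℕ) : Prop :=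
  i + k ≤ n + 1 ∧
    ∀ a b : Fin n, i ≤ (a : ℕ) + 1 → (b : ℕ) = (a : ℕ) + 1 → (b : ℕ) + 2 ≤ i + k → w b < w a

instance (k : ℕ) {n : ℕ} (w : Equiv.Perm (Fin n)) (i : ℕ) :
    Decidable (IsKDescentStart k w i) := by
  unfold IsKDescentStart
  infer_instance

/-- `D_k(w)`: the set of starting points `i ∈ [n]` of `k`-descents of `w ∈ S_n`. -/
def kDescentSet (k : ℕ) {n : ℕ} (w : Equiv.Perm (Fin n)) : Finset ℕ :=
  (Finset.Icc 1 n).filter (fun i => IsKDescentStart k w i)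

/-- The `k`-descent function `d_k(I, n)`: the number of `w ∈ S_n` with `D_k(w) = I`. -/
def kDescentFun (k : ℕ) (I : Finset ℕ) (n : ℕ) : ℕ :=
  (Finset.univ.filter (fun w : Equiv.Perm (Fin n) => kDescentSet k w = I)).card

/-- `f_k(n) = d_k(∅, n)`: the number of `w ∈ S_n` that avoid `k`-descents. -/
def kDescentAvoiding (k n : ℕ) : ℕ := kDescentFun k ∅ n

/-!
Encode a permutation `w` of length `n` by its descent set `S`; a `k`-descent starts at `s` when `S`
contains the `k - 1` consecutive positions from `s` on. Write `q n` for the proportion of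
permutations without `k`-descents.

Fix a condition on the first `N` entries. Permutations that satisfy it, have an ascent after
position `N` and have no `k`-descent starting later can be counted by inclusion and exclusion on the
length of the decreasing run that crosses position `N`. Since the relative orders of the first `M`
and of the remaining entries of a random permutation are independent (`descProb_split`), each term is
a product, and only run lengths congruent to `0` or `1` modulo `k` survive. The result,
`descProb_eq_sum`, says that the proportion in question is a convolution of `q` with coefficients
bounded by `1 / j!`. For `N = 0` it is the identity
`(∑ₙ q n xⁿ) (∑ⱼ (x ^ (jk) / (jk)! - x ^ (jk + 1) / (jk + 1)!)) = 1`, and for `N = max I + k - 1` it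
concerns the permutations whose `k`-descents start exactly at the elements of `I`.

The second factor `Q` has a root `L` in `[1, 5/4]`. The power series `Q (L x) / (1 - x)` has the
partial sums of `Q L` as coefficients, and these are so small, apart from the first one, that the
series is invertible in a weighted `ℓ¹` algebra (`summable_inverse`, `weighted_partial_sums_lt_one`).
Hence `q n * L ^ n` and its convolutions converge exponentially fast, the former to a nonzero limit
(`exists_exp_asymptotics`). Consequently the ratio `d_k(I, n) / f_k(n)` converges exponentially fast.

The limit of the ratio is positive as soon as one permutation has `I` as its set of starting points:
rearranging boundedly many initial entries turns any permutation without `k`-descents into such a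
permutation (`avoidProb_le_mul`). Therefore the error is small relative to the main term.
-/

/-! ### Descent sets of random permutations -/

/-- The descent set of `f : Fin n → α`, encoded by the 0-based position of the lower entry: for
`0 < i < n` the number `i` belongs to it when `f i < f (i - 1)`. The position `0`, which has no
predecessor, belongs to it by convention as soon as `0 < n`; thus an initial decreasing run behaves
like one that continues a previous entry `+∞`. -/
def descSet {α : Type*} [LinearOrder α] {n : ℕ} (f : Fin n → α) : Finset ℕ :=
  (Finset.range n).filter fun i => ∀ a b : Fin n, (b : ℕ) = i → (a : ℕ) + 1 = i → f b < f a

theorem mem_descSet {α : Type*} [LinearOrder α] {n : ℕ} {f : Fin n → α} {i : ℕ} :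
    i ∈ descSet f ↔ i < n ∧ ∀ a b : Fin n, (b : ℕ) = i → (a : ℕ) + 1 = i → f b < f a := by
  simp [descSet]

theorem descSet_congr {α β : Type*} [LinearOrder α] [LinearOrder β] {n : ℕ} {f : Fin n → α}
    {g : Fin n → β} (h : ∀ i j, f i < f j ↔ g i < g j) : descSet f = descSet g := by
  ext i
  simp only [mem_descSet, h]

theorem descSet_castAdd {α : Type*} [LinearOrder α] {M L : ℕ} (f : Fin (M + L) → α) (i : ℕ) :
    i ∈ descSet (f ∘ Fin.castAdd L) ↔ i < M ∧ i ∈ descSet f := by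
  simp only [mem_descSet, Function.comp]
  constructor
  · rintro ⟨hi, h⟩
    refine ⟨hi, by omega, fun a b hb ha => ?_⟩
    exact h ⟨a, by omega⟩ ⟨b, by omega⟩ hb ha
  · rintro ⟨hi, -, h⟩
    exact ⟨hi, fun a b hb ha => h _ _ hb ha⟩

theorem descSet_natAdd {α : Type*} [LinearOrder α] {M L : ℕ} (f : Fin (M + L) → α) {i : ℕ}
    (hi : 1 ≤ i) : i ∈ descSet (f ∘ Fin.natAdd M) ↔ M + i ∈ descSet f := by
  simp only [mem_descSet, Function.comp]
  constructor
  · rintro ⟨hi', h⟩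
    refine ⟨by omega, fun a b hb ha => ?_⟩
    have := h ⟨a - M, by omega⟩ ⟨b - M, by omega⟩ (by simp; omega) (by simp; omega)
    convert this using 2 <;> ext <;> simp <;> omega
  · rintro ⟨hi', h⟩
    exact ⟨by omega, fun a b hb ha => h _ _ (by simp; omega) (by simp; omega)⟩

/-- Every injective sequence of length `M` has the same relative order as a permutation. -/
theorem exists_perm_lt_iff {α : Type*} [LinearOrder α] {M : ℕ} (f : Fin M → α)
    (hf : Function.Injective f) : ∃ π : Equiv.Perm (Fin M), ∀ i j, f i < f j ↔ π i < π j := by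
  have hs : StrictMono (f ∘ Tuple.sort f) :=
    (Tuple.monotone_sort f).strictMono_of_injective (hf.comp (Tuple.sort f).injective)
  refine ⟨(Tuple.sort f)⁻¹, fun i j => ?_⟩
  have := hs.lt_iff_lt (a := (Tuple.sort f)⁻¹ i) (b := (Tuple.sort f)⁻¹ j)
  simpa using this

open Classical in
/-- The proportion of the permutations of `Fin n` whose descent set satisfies `R`. -/
noncomputable def descProb (n : ℕ) (R : Finset ℕ → Prop) : ℝ :=
  ((Finset.univ.filter fun w : Equiv.Perm (Fin n) => R (descSet w)).card : ℝ) / n.factorial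

open Classical in
theorem descProb_mul_factorial (n : ℕ) (R : Finset ℕ → Prop) :
    descProb n R * n.factorial =
      ∑ w : Equiv.Perm (Fin n), if R (descSet w) then (1 : ℝ) else 0 := by
  rw [descProb, div_mul_cancel₀ _ (by positivity), Finset.sum_boole]

theorem descProb_nonneg (n : ℕ) (R : Finset ℕ → Prop) : 0 ≤ descProb n R := by
  unfold descProb; positivity

theorem descProb_mono {n : ℕ} {R R' : Finset ℕ → Prop}
    (h : ∀ w : Equiv.Perm (Fin n), R (descSet w) → R' (descSet w)) :
    descProb n R ≤ descProb n R' := by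
  unfold descProb
  gcongr with w
  exact h w

theorem descProb_congr {n : ℕ} {R R' : Finset ℕ → Prop}
    (h : ∀ w : Equiv.Perm (Fin n), R (descSet w) ↔ R' (descSet w)) :
    descProb n R = descProb n R' :=
  le_antisymm (descProb_mono fun w => (h w).1) (descProb_mono fun w => (h w).2)

theorem descProb_eq_zero {n : ℕ} {R : Finset ℕ → Prop}
    (h : ∀ w : Equiv.Perm (Fin n), ¬ R (descSet w)) : descProb n R = 0 := by
  simp [descProb, h]

theorem descProb_true (n : ℕ) : descProb n (fun _ => True) = 1 := by
  have : (n.factorial : ℝ) ≠ 0 := by positivity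
  simp [descProb, Fintype.card_perm, this]

theorem descProb_eq_add (n : ℕ) (R T : Finset ℕ → Prop) :
    descProb n R = descProb n (fun S => R S ∧ T S) + descProb n (fun S => R S ∧ ¬ T S) := by
  classical
  simp only [descProb, ← add_div]
  congr 1
  norm_cast
  rw [← Finset.card_filter_add_card_filter_not (p := fun w : Equiv.Perm (Fin n) => T (descSet w))]
  simp only [Finset.filter_filter]

/-- The relative orders of the first `M` and of the last `L` entries of a uniformly random
permutation are independent and uniform. -/
theorem descProb_split (M L : ℕ) (F G : Finset ℕ → Prop) (R : Finset ℕ → Prop)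
    (hR : ∀ w : Equiv.Perm (Fin (M + L)), R (descSet w) ↔
      F (descSet (w ∘ Fin.castAdd L)) ∧ G (descSet (w ∘ Fin.natAdd M))) :
    descProb (M + L) R = descProb M F * descProb L G := by
  classical
  set φ : Equiv.Perm (Fin (M + L)) → ℝ := fun w =>
    (if F (descSet (w ∘ Fin.castAdd L)) then 1 else 0) *
      (if G (descSet (w ∘ Fin.natAdd M)) then 1 else 0) with hφ
  have h0 : descProb (M + L) R * (M + L).factorial = ∑ w, φ w := by
    rw [descProb_mul_factorial]
    refine Finset.sum_congr rfl fun w _ => ?_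
    simp only [hφ, hR w, ite_and, mul_ite, mul_one, mul_zero]
    split_ifs <;> rfl
  -- `act σ τ` permutes the first `M` positions by `σ` and the last `L` positions by `τ`.
  set act : Equiv.Perm (Fin M) → Equiv.Perm (Fin L) → Equiv.Perm (Fin (M + L)) := fun σ τ =>
    (finSumFinEquiv.symm.trans (Equiv.sumCongr σ τ)).trans finSumFinEquiv with hact
  have hinv : ∀ σ τ, ∑ w, φ (w * act σ τ) = ∑ w, φ w := fun σ τ =>
    Equiv.sum_comp (Equiv.mulRight (act σ τ)) φ
  have hfib : ∀ w : Equiv.Perm (Fin (M + L)), ∑ σ, ∑ τ, φ (w * act σ τ) =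
      (descProb M F * M.factorial) * (descProb L G * L.factorial) := by
    intro w
    obtain ⟨π, hπ⟩ := exists_perm_lt_iff (w ∘ Fin.castAdd L)
      (w.injective.comp (Fin.castAdd_injective M L))
    obtain ⟨ψ, hψ⟩ := exists_perm_lt_iff (w ∘ Fin.natAdd M)
      (w.injective.comp (Fin.natAdd_injective L M))
    have h1 : ∀ σ τ, descSet ((w * act σ τ : Equiv.Perm _) ∘ Fin.castAdd L)
        = descSet (π * σ : Equiv.Perm _) := fun σ τ => descSet_congr fun i j => by
      simpa [hact] using hπ (σ i) (σ j)
    have h2 : ∀ σ τ, descSet ((w * act σ τ : Equiv.Perm _) ∘ Fin.natAdd M)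
        = descSet (ψ * τ : Equiv.Perm _) := fun σ τ => descSet_congr fun i j => by
      simpa [hact] using hψ (τ i) (τ j)
    simp only [hφ, h1, h2]
    rw [descProb_mul_factorial, descProb_mul_factorial, ← Finset.sum_mul_sum]
    congr 1
    · exact Equiv.sum_comp (Equiv.mulLeft π)
        (fun σ : Equiv.Perm (Fin M) => if F (descSet σ) then (1 : ℝ) else 0)
    · exact Equiv.sum_comp (Equiv.mulLeft ψ)
        (fun σ : Equiv.Perm (Fin L) => if G (descSet σ) then (1 : ℝ) else 0)
  have h1 : ∑ σ, ∑ τ, ∑ w, φ (w * act σ τ) =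
      ((M + L).factorial : ℝ) *
        ((descProb M F * M.factorial) * (descProb L G * L.factorial)) := by
    calc ∑ σ, ∑ τ, ∑ w, φ (w * act σ τ) = ∑ w, ∑ σ, ∑ τ, φ (w * act σ τ) := by
          rw [Finset.sum_comm]
          simp_rw [Finset.sum_comm (s := (Finset.univ : Finset (Equiv.Perm (Fin M))))]
          rw [Finset.sum_comm]
      _ = _ := by simp [hfib, Fintype.card_perm]
  simp only [hinv, ← h0, Finset.sum_const, Finset.card_univ, Fintype.card_perm, Fintype.card_fin,
    nsmul_eq_mul] at h1
  have e1 : (M.factorial : ℝ) ≠ 0 := by positivity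
  have e2 : (L.factorial : ℝ) ≠ 0 := by positivity
  have e3 : ((M + L).factorial : ℝ) ≠ 0 := by positivity
  have e4 : ((M.factorial : ℝ) * L.factorial * (M + L).factorial) ≠ 0 := by positivity
  apply mul_left_cancel₀ e4
  linear_combination h1

/-- The decreasing arrangement is the only one whose descent set is everything. -/
theorem descProb_all (j : ℕ) :
    descProb j (fun S => ∀ i < j, i ∈ S) = 1 / j.factorial := by
  classical
  have : (Finset.univ.filter fun w : Equiv.Perm (Fin j) => ∀ i < j, i ∈ descSet w) =
      {Fin.revPerm} := by
    ext w
    simp only [Finset.mem_filter, Finset.mem_univ, true_and, Finset.mem_singleton]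
    constructor
    · intro h
      have hanti : StrictAnti w := by
        cases j with
        | zero => exact fun a => a.elim0
        | succ j =>
          rw [Fin.strictAnti_iff_succ_lt]
          intro i
          exact (mem_descSet.1 (h (i + 1) (by omega))).2 _ _ (by simp) (by simp)
      have hmono : StrictMono (w ∘ Fin.rev) := hanti.comp Fin.rev_strictAnti
      have hid : w ∘ Fin.rev = id := by
        rw [← hmono.range_inj strictMono_id]
        rw [(w.surjective.comp Fin.rev_surjective).range_eq, Set.range_id]
      ext i
      have := congrFun hid (Fin.rev i)
      simp at this
      simp [this]
    · rintro rfl i hi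
      refine mem_descSet.2 ⟨hi, fun a b hb ha => ?_⟩
      simp [Fin.lt_def]
      omega
  have hc := congrArg Finset.card this
  rw [Finset.card_singleton] at hc
  rw [descProb]
  congr 1
  norm_cast
  convert hc

/-! ### Starting points of `k`-descents -/

/-- In terms of the descent set `S`, the 1-based index `s` starts a `k`-descent. -/
def HasRun (k : ℕ) (S : Finset ℕ) (s : ℕ) : Prop := ∀ i, s ≤ i → i + 1 < s + k → i ∈ S

/-- No `k`-descent starts at a 1-based index greater than `M`. -/
def AvoidsAfter (k M : ℕ) (S : Finset ℕ) : Prop := ∀ s, M < s → ¬ HasRun k S s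

/-- Positions `N, …, N + j - 1` (0-based) all belong to the descent set. -/
def DescOn (N j : ℕ) (S : Finset ℕ) : Prop := ∀ i, N ≤ i → i < N + j → i ∈ S

theorem hasRun_natAdd {α : Type*} [LinearOrder α] {k M L : ℕ} (f : Fin (M + L) → α) {s : ℕ}
    (hs : 1 ≤ s) :
    HasRun k (descSet (f ∘ Fin.natAdd M)) s ↔ HasRun k (descSet f) (M + s) := by
  constructor
  · intro h i hi hi'
    have := h (i - M) (by omega) (by omega)
    rw [descSet_natAdd _ (by omega)] at this
    rwa [Nat.add_sub_cancel' (by omega)] at this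
  · intro h i hi hi'
    rw [descSet_natAdd _ (by omega)]
    exact h _ (by omega) (by omega)

theorem isKDescentStart_iff {k n : ℕ} (hk : 2 ≤ k) (w : Equiv.Perm (Fin n)) {s : ℕ} (hs : 1 ≤ s) :
    IsKDescentStart k w s ↔ HasRun k (descSet w) s := by
  constructor
  · rintro ⟨h1, h2⟩ i hi hi'
    exact mem_descSet.2 ⟨by omega, fun a b hb ha => h2 a b (by omega) (by omega) (by omega)⟩
  · intro h
    refine ⟨?_, fun a b ha hb hb' => ?_⟩
    · have := (mem_descSet.1 (h (s + k - 2) (by omega) (by omega))).1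
      omega
    · exact (mem_descSet.1 (h b (by omega) (by omega))).2 a b rfl hb.symm

theorem kDescentSet_eq_iff {k n : ℕ} (hk : 2 ≤ k) (w : Equiv.Perm (Fin n)) {I : Finset ℕ}
    (hI : ∀ i ∈ I, 1 ≤ i) :
    kDescentSet k w = I ↔ ∀ s, 1 ≤ s → (HasRun k (descSet w) s ↔ s ∈ I) := by
  have hmem : ∀ s, s ∈ kDescentSet k w ↔ 1 ≤ s ∧ HasRun k (descSet w) s := by
    intro s
    simp only [kDescentSet, Finset.mem_filter, Finset.mem_Icc]
    constructor
    · rintro ⟨⟨h1, -⟩, h2⟩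
      exact ⟨h1, (isKDescentStart_iff hk w h1).1 h2⟩
    · rintro ⟨h1, h2⟩
      have h3 := (isKDescentStart_iff hk w h1).2 h2
      exact ⟨⟨h1, by have := h3.1; omega⟩, h3⟩
  constructor
  · rintro rfl s hs
    simp [hmem, hs]
  · intro h
    ext s
    rw [hmem]
    exact ⟨fun ⟨h1, h2⟩ => (h s h1).1 h2, fun h1 => ⟨hI s h1, (h s (hI s h1)).2 h1⟩⟩

theorem kDescentFun_eq {k : ℕ} (hk : 2 ≤ k) (n : ℕ) {I : Finset ℕ} (hI : ∀ i ∈ I, 1 ≤ i) :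
    (kDescentFun k I n : ℝ) =
      descProb n (fun S => ∀ s, 1 ≤ s → (HasRun k S s ↔ s ∈ I)) * n.factorial := by
  classical
  rw [descProb, div_mul_cancel₀ _ (by positivity)]
  norm_cast
  rw [kDescentFun]
  congr 1
  ext w
  simp [kDescentSet_eq_iff hk w hI]

/-- The proportion of permutations without `k`-descents. -/
noncomputable def avoidProb (k n : ℕ) : ℝ := descProb n (AvoidsAfter k 0)

theorem kDescentAvoiding_eq {k : ℕ} (hk : 2 ≤ k) (n : ℕ) :
    (kDescentAvoiding k n : ℝ) = avoidProb k n * n.factorial := by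
  rw [kDescentAvoiding, kDescentFun_eq hk n (by simp), avoidProb]
  congr 1
  refine descProb_congr fun w => forall_congr' fun s => ?_
  simp [Nat.lt_iff_add_one_le]

/-! ### The recurrence -/

/-- The events "descent at `M`, no `k`-descent starting after `M`" and "descent at `M`, no `k`-descent
starting after `M + 1`" differ by the permutations in which `M + 1` itself starts a `k`-descent. In
that case the positions `M, …, M + k - 1` are descents, and `M + k` is not one because `M + 2` does
not start a `k`-descent. -/
theorem descProb_run_step {k : ℕ} (hk : 2 ≤ k) (n M : ℕ) (P : Finset ℕ → Prop) :
    descProb n (fun S => P S ∧ AvoidsAfter k M S ∧ M ∉ S) -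
      descProb n (fun S => (P S ∧ DescOn M k S) ∧ AvoidsAfter k (M + k) S ∧ M + k ∉ S) =
    descProb n (fun S => P S ∧ AvoidsAfter k M S) -
      descProb n (fun S => (P S ∧ DescOn M 1 S) ∧ AvoidsAfter k (M + 1) S) := by
  have h1 := descProb_eq_add n (fun S => P S ∧ AvoidsAfter k M S) (fun S => M ∈ S)
  have h2 := descProb_eq_add n (fun S => (P S ∧ DescOn M 1 S) ∧ AvoidsAfter k (M + 1) S)
    (fun S => HasRun k S (M + 1))
  have h3 : descProb n (fun S => P S ∧ AvoidsAfter k M S ∧ M ∉ S) =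
      descProb n (fun S => (P S ∧ AvoidsAfter k M S) ∧ M ∉ S) :=
    descProb_congr fun w => by tauto
  have h4 : descProb n (fun S => (P S ∧ AvoidsAfter k M S) ∧ M ∈ S) =
      descProb n (fun S => ((P S ∧ DescOn M 1 S) ∧ AvoidsAfter k (M + 1) S) ∧
        ¬ HasRun k S (M + 1)) := by
    refine descProb_congr fun w => ?_
    constructor
    · rintro ⟨⟨hP, hA⟩, hM⟩
      refine ⟨⟨⟨hP, fun i hi hi' => ?_⟩, fun s hs => hA s (by omega)⟩, hA _ (by omega)⟩
      obtain rfl : i = M := by omega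
      exact hM
    · rintro ⟨⟨⟨hP, hD⟩, hA⟩, hR⟩
      refine ⟨⟨hP, fun s hs => ?_⟩, hD M le_rfl (by omega)⟩
      rcases Nat.eq_or_lt_of_le (show M + 1 ≤ s from hs) with rfl | h
      · exact hR
      · exact hA s h
  have h5 : descProb n (fun S => (P S ∧ DescOn M k S) ∧ AvoidsAfter k (M + k) S ∧ M + k ∉ S) =
      descProb n (fun S => ((P S ∧ DescOn M 1 S) ∧ AvoidsAfter k (M + 1) S) ∧
        HasRun k S (M + 1)) := by
    refine descProb_congr fun w => ?_
    constructor
    · rintro ⟨⟨hP, hD⟩, hA, hM⟩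
      refine ⟨⟨⟨hP, fun i hi hi' => hD i hi (by omega)⟩, fun s hs hR => ?_⟩,
        fun i hi hi' => hD i (by omega) (by omega)⟩
      by_cases h : M + k < s
      · exact hA s h hR
      · exact hM (hR _ (by omega) (by omega))
    · rintro ⟨⟨⟨hP, hD⟩, hA⟩, hR⟩
      have hD' : DescOn M k (descSet w) := fun i hi hi' => by
        rcases Nat.eq_or_lt_of_le hi with rfl | h
        · exact hD M le_rfl (by omega)
        · exact hR i h (by omega)
      refine ⟨⟨hP, hD'⟩, fun s hs => hA s (by omega), fun hM => hA (M + 2) (by omega) ?_⟩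
      intro i hi hi'
      by_cases h : i = M + k
      · exact h ▸ hM
      · exact hD' i (by omega) (by omega)
  rw [h3, h5]
  linarith

/-- The coefficient of `x ^ j` in `∑ᵢ (x ^ (i k) - x ^ (i k + 1))`, for `2 ≤ k`. -/
def signCoeff (k j : ℕ) : ℝ := if j % k = 0 then 1 else if j % k = 1 then -1 else 0

theorem sum_signCoeff_mul {k : ℕ} (hk : 2 ≤ k) (A : ℕ → ℝ) (T : ℕ) :
    ∑ j ∈ Finset.range (T * k), signCoeff k j * A j =
      ∑ t ∈ Finset.range T, (A (t * k) - A (t * k + 1)) := by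
  induction T with
  | zero => simp
  | succ T ih =>
    rw [Finset.sum_range_succ, ← ih, Nat.succ_mul, Finset.sum_range_add]
    congr 1
    obtain ⟨m, rfl⟩ : ∃ m, k = m + 2 := ⟨k - 2, by omega⟩
    rw [Finset.sum_range_succ', Finset.sum_range_succ', Finset.sum_eq_zero]
    · have h1 : (T * (m + 2) + 1) % (m + 2) = 1 := by
        rw [add_comm, Nat.add_mul_mod_self_right, Nat.mod_eq_of_lt (by omega)]
      simp [signCoeff, h1]
      ring
    · intro r hr
      rw [Finset.mem_range] at hr
      have h1 : (T * (m + 2) + (r + 1 + 1)) % (m + 2) = r + 2 := by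
        rw [add_comm, Nat.add_mul_mod_self_right, Nat.mod_eq_of_lt (by omega)]
      simp [signCoeff, h1]

/-- The proportion of permutations of length `N + j` that satisfy `P` and whose last `j` steps are
descents. -/
noncomputable def runProb (P : Finset ℕ → Prop) (N j : ℕ) : ℝ :=
  descProb (N + j) (fun S => P S ∧ DescOn N j S)

theorem runProb_nonneg (P : Finset ℕ → Prop) (N j : ℕ) : 0 ≤ runProb P N j := descProb_nonneg _ _

theorem runProb_le (P : Finset ℕ → Prop) (N j : ℕ) : runProb P N j ≤ 1 / j.factorial := by
  rw [← descProb_all, ← one_mul (descProb j _), ← descProb_true N,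
    ← descProb_split N j (fun _ => True) (fun S => ∀ i < j, i ∈ S)
      (fun S => ∀ i, 1 ≤ i → i < j → N + i ∈ S)]
  · exact descProb_mono fun w hw i hi hi' => hw.2 _ (by omega) (by omega)
  · intro w
    rw [true_and]
    refine forall_congr' fun i => ?_
    rcases Nat.eq_zero_or_pos i with rfl | hi
    · simp [mem_descSet]
    · simp [descSet_natAdd _ hi, Nat.succ_le_iff, hi]

/-- The recurrence expressing the proportion of permutations with a condition `P` on the first `N`
entries, an ascent after them, and no later `k`-descents, through avoiding permutations. -/
theorem descProb_eq_sum {k : ℕ} (hk : 2 ≤ k) (N : ℕ) (P : Finset ℕ → Prop)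
    (hP : ∀ S S' : Finset ℕ, (∀ i < N, i ∈ S ↔ i ∈ S') → (P S ↔ P S')) (n : ℕ) :
    descProb (N + n) (fun S => P S ∧ AvoidsAfter k N S ∧ N ∉ S) =
      ∑ j ∈ Finset.range (n + 1),
        signCoeff k j * runProb P N j * avoidProb k (n - j) := by
  set A : ℕ → ℝ := fun j =>
    descProb (N + n) (fun S => (P S ∧ DescOn N j S) ∧ AvoidsAfter k (N + j) S) with hA
  set E : ℕ → ℝ := fun j =>
    descProb (N + n) (fun S => (P S ∧ DescOn N j S) ∧ AvoidsAfter k (N + j) S ∧ N + j ∉ S) with hE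
  have hstep : ∀ j, E j - E (j + k) = A j - A (j + 1) := by
    intro j
    have hD : ∀ S i, ((P S ∧ DescOn N j S) ∧ DescOn (N + j) i S) ↔ (P S ∧ DescOn N (j + i) S) := by
      intro S i
      rw [and_assoc]
      refine and_congr_right fun _ => ⟨fun ⟨h1, h2⟩ a ha ha' => ?_, fun h => ⟨?_, ?_⟩⟩
      · by_cases h : a < N + j
        · exact h1 a ha h
        · exact h2 a (by omega) (by omega)
      · exact fun a ha ha' => h a ha (by omega)
      · exact fun a ha ha' => h a (by omega) (by omega)
    have := descProb_run_step hk (N + n) (N + j) (fun S => P S ∧ DescOn N j S)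
    simp only [hD, add_assoc] at this
    simpa only [hA, hE] using this
  have hzero : ∀ (R : Finset ℕ → Prop) j, n < j →
      descProb (N + n) (fun S => (P S ∧ DescOn N j S) ∧ R S) = 0 := by
    intro R j hj
    refine descProb_eq_zero fun w hw => ?_
    have := (mem_descSet.1 (hw.1.2 (N + n) (by omega) (by omega))).1
    omega
  -- The differences telescope, and `E` vanishes at `(n + 1) * k > n`.
  have htel : ∑ t ∈ Finset.range (n + 1), (A (t * k) - A (t * k + 1)) = E 0 := by
    have : ∀ t, A (t * k) - A (t * k + 1) = E (t * k) - E ((t + 1) * k) := by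
      intro t
      rw [← hstep, Nat.succ_mul]
    simp only [this]
    rw [Finset.sum_range_sub' (fun t => E (t * k))]
    have h0 : E ((n + 1) * k) = 0 := hzero _ _ (by nlinarith)
    simp [h0]
  have hfac : ∀ j ≤ n, A j = runProb P N j * avoidProb k (n - j) := by
    intro j hj
    have hn : N + n = (N + j) + (n - j) := by omega
    simp only [hA, hn]
    rw [runProb, avoidProb]
    refine descProb_split _ _ _ _ _ fun w => and_congr ?_ ?_
    · refine and_congr (hP _ _ fun i hi => ?_) ?_
      · rw [descSet_castAdd]
        constructor
        · exact fun h => ⟨by omega, h⟩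
        · exact fun h => h.2
      · refine forall_congr' fun i => ?_
        rw [descSet_castAdd]
        tauto
    · constructor
      · exact fun h s hs hR => h (N + j + s) (by omega) ((hasRun_natAdd _ hs).1 hR)
      · intro h s hs hR
        refine h (s - (N + j)) (by omega) ((hasRun_natAdd _ (by omega)).2 ?_)
        rwa [Nat.add_sub_cancel' (by omega)]
  have h0 : descProb (N + n) (fun S => P S ∧ AvoidsAfter k N S ∧ N ∉ S) = E 0 := by
    refine descProb_congr fun w => ?_
    have : DescOn N 0 (descSet w) := fun i hi hi' => by omega
    simp [this]
  rw [h0, ← htel, ← sum_signCoeff_mul hk]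
  have hle : n + 1 ≤ (n + 1) * k := by nlinarith
  rw [← Finset.sum_subset (Finset.range_mono hle)]
  · refine Finset.sum_congr rfl fun j hj => ?_
    rw [hfac j (by simpa [Nat.lt_succ_iff] using hj), mul_assoc]
  · intro j _ hj
    simp only [Finset.mem_range, not_lt] at hj
    have : A j = 0 := hzero _ _ (by omega)
    rw [this, mul_zero]

/-- The classical generating function identity for permutations without `k`-descents. It is the case
`N = 0` of the recurrence: position `0` is a descent by convention, so the left-hand side there
vanishes unless the permutation is empty. -/
theorem sum_signCoeff_avoidProb {k : ℕ} (hk : 2 ≤ k) (n : ℕ) :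
    ∑ j ∈ Finset.range (n + 1), signCoeff k j / j.factorial * avoidProb k (n - j) =
      if n = 0 then 1 else 0 := by
  have h := descProb_eq_sum hk 0 (fun _ => True) (fun _ _ _ => Iff.rfl) n
  have hr : ∀ j, runProb (fun _ => True) 0 j = 1 / j.factorial := by
    intro j
    rw [← descProb_all, runProb, zero_add]
    refine descProb_congr fun w => ?_
    simp [DescOn]
  simp only [hr, zero_add, mul_one_div] at h
  rw [← h]
  split_ifs with hn
  · subst hn
    rw [← descProb_true 0]
    refine descProb_congr fun w => ?_
    refine ⟨fun _ => trivial, fun _ => ⟨trivial, fun s hs hR => ?_, by simp [mem_descSet]⟩⟩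
    have := (mem_descSet.1 (hR s le_rfl (by omega))).1
    omega
  · refine descProb_eq_zero fun w hw => hw.2.2 (mem_descSet.2 ⟨by omega, fun a b _ h => by omega⟩)

theorem avoidProb_pos {k : ℕ} (hk : 2 ≤ k) (n : ℕ) : 0 < avoidProb k n := by
  classical
  rw [avoidProb, descProb]
  refine div_pos ?_ (by positivity)
  rw [Nat.cast_pos, Finset.card_pos]
  refine ⟨1, Finset.mem_filter.2 ⟨Finset.mem_univ _, fun s hs hR => ?_⟩⟩
  obtain ⟨h1, h2⟩ := mem_descSet.1 (hR s le_rfl (by omega))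
  have := h2 ⟨s - 1, by omega⟩ ⟨s, h1⟩ rfl (by simp; omega)
  simp only [Fin.lt_def, Equiv.Perm.coe_one, id_eq] at this
  omega

/-! ### Inversion in weighted `ℓ¹` algebras -/

open Finset in
/-- A formal power series `s = 1 + ⋯` whose remaining coefficients have weighted `ℓ¹` norm less than
`1` has an inverse of finite weighted `ℓ¹` norm. -/
theorem summable_inverse {s b : ℕ → ℝ} {t : ℝ} (ht : 0 ≤ t) (h0 : s 0 = 1)
    (hs : Summable fun n => |s (n + 1)| * t ^ (n + 1))
    (hθ : ∑' n, |s (n + 1)| * t ^ (n + 1) < 1)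
    (hb : ∀ n, ∑ j ∈ range (n + 1), s j * b (n - j) = if n = 0 then 1 else 0) :
    Summable fun n => |b n| * t ^ n := by
  set u : ℕ → ℝ := fun j => |s (j + 1)| * t ^ (j + 1) with hu
  set B : ℕ → ℝ := fun n => |b n| * t ^ n with hB
  set θ := ∑' n, u n with hθ'
  have hu0 : ∀ j, 0 ≤ u j := fun j => by positivity
  have hB0 : ∀ j, 0 ≤ B j := fun j => by positivity
  have hB00 : B 0 = 1 := by
    have := hb 0
    simp [h0] at this
    simp [hB, this]
  have hBs : ∀ n, B (n + 1) ≤ ∑ j ∈ range (n + 1), u j * B (n - j) := by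
    intro n
    have h := hb (n + 1)
    rw [sum_range_succ', h0, one_mul, if_neg n.succ_ne_zero, Nat.sub_zero] at h
    have h' : b (n + 1) = -∑ j ∈ range (n + 1), s (j + 1) * b (n + 1 - (j + 1)) := by linarith
    calc B (n + 1) = |∑ j ∈ range (n + 1), s (j + 1) * b (n + 1 - (j + 1))| * t ^ (n + 1) := by
          simp only [hB, h', abs_neg]
      _ ≤ (∑ j ∈ range (n + 1), |s (j + 1) * b (n + 1 - (j + 1))|) * t ^ (n + 1) := by
          gcongr
          exact abs_sum_le_sum_abs _ _
      _ = _ := by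
          rw [sum_mul]
          refine sum_congr rfl fun j hj => ?_
          rw [mem_range] at hj
          have : n + 1 = (j + 1) + (n - j) := by omega
          have e : n + 1 - (j + 1) = n - j := by omega
          rw [e, abs_mul]
          simp only [hu, hB]
          conv_lhs => rw [this, pow_add]
          ring
  refine summable_of_sum_range_le (c := 1 / (1 - θ)) hB0 fun K => ?_
  -- Summing the recurrence for `B` gives a bound on partial sums in terms of themselves.
  have hT : ∑ n ∈ range (K + 1), B n ≤ 1 + θ * ∑ n ∈ range (K + 1), B n := by
    calc ∑ n ∈ range (K + 1), B n = ∑ n ∈ range K, B (n + 1) + 1 := by rw [sum_range_succ', hB00]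
      _ ≤ ∑ n ∈ range K, ∑ j ∈ range (n + 1), u j * B (n - j) + 1 := by
          gcongr with n
          exact hBs n
      _ = ∑ j ∈ range K, ∑ i ∈ range (K - j), u j * B i + 1 := by
          rw [sum_range_diag_flip K (fun i j => u i * B j)]
      _ ≤ ∑ j ∈ range K, u j * ∑ i ∈ range (K + 1), B i + 1 := by
          gcongr with j
          rw [← mul_sum]
          refine mul_le_mul_of_nonneg_left ?_ (hu0 j)
          exact sum_le_sum_of_subset_of_nonneg (range_mono (by omega)) fun i _ _ => hB0 i
      _ ≤ _ := by
          rw [← sum_mul, add_comm]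
          have := hs.sum_le_tsum (Finset.range K) fun i _ => hu0 i
          exact add_le_add_right
            (mul_le_mul_of_nonneg_right this (sum_nonneg fun i _ => hB0 i)) 1
  have h1 : ∑ n ∈ range K, B n ≤ ∑ n ∈ range (K + 1), B n :=
    sum_le_sum_of_subset_of_nonneg (range_mono (by omega)) fun i _ _ => hB0 i
  refine h1.trans ?_
  rw [le_div_iff₀ (by linarith)]
  linarith

/-- Weighted `ℓ¹` sequences are closed under convolution. -/
theorem summable_conv {a b : ℕ → ℝ} {t : ℝ} (ht : 0 ≤ t) (ha : Summable fun n => |a n| * t ^ n)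
    (hb : Summable fun n => |b n| * t ^ n) :
    Summable fun n => |∑ j ∈ Finset.range (n + 1), a j * b (n - j)| * t ^ n := by
  have hn : ∀ x : ℕ → ℝ, (fun n => |x n| * t ^ n) = fun n => ‖x n * t ^ n‖ := by
    intro x
    ext n
    rw [norm_mul, Real.norm_eq_abs, norm_pow, Real.norm_of_nonneg ht]
  rw [hn] at ha hb
  have := summable_norm_sum_mul_range_of_summable_norm ha hb
  rw [hn fun n => ∑ j ∈ Finset.range (n + 1), a j * b (n - j)]
  refine this.congr fun n => ?_
  congr 1
  rw [Finset.sum_mul]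
  refine Finset.sum_congr rfl fun j hj => ?_
  rw [Finset.mem_range] at hj
  have : n = j + (n - j) := by omega
  conv_rhs => rw [this, pow_add]
  simp only [Nat.add_sub_cancel_left]
  ring

theorem summable_abs_of_weighted {x : ℕ → ℝ} {t : ℝ} (ht : 1 ≤ t)
    (hx : Summable fun n => |x n| * t ^ n) : Summable fun n => |x n| :=
  Summable.of_nonneg_of_le (fun _ => abs_nonneg _)
    (fun _ => le_mul_of_one_le_right (abs_nonneg _) (one_le_pow₀ ht)) hx

/-- The partial sums of a weighted `ℓ¹` series converge exponentially fast. -/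
theorem abs_partial_sum_sub_tsum_le {x : ℕ → ℝ} {t : ℝ} (ht : 1 ≤ t)
    (hx : Summable fun i => |x i| * t ^ i) (n : ℕ) :
    |∑ i ∈ Finset.range (n + 1), x i - ∑' i, x i| ≤ (∑' i, |x i| * t ^ i) * t⁻¹ ^ n := by
  have ht0 : 0 < t := by linarith
  have h1 := summable_abs_of_weighted ht hx
  have h2 := (summable_nat_add_iff (n + 1)).2 h1
  have h3 := (summable_nat_add_iff (n + 1)).2 hx
  rw [← h1.of_abs.sum_add_tsum_nat_add (n + 1), sub_add_cancel_left, abs_neg]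
  calc |∑' i, x (i + (n + 1))| ≤ ∑' i, |x (i + (n + 1))| := by
        simpa only [Real.norm_eq_abs] using norm_tsum_le_tsum_norm
          (f := fun i => x (i + (n + 1))) (by simpa only [Real.norm_eq_abs] using h2)
    _ ≤ ∑' i, (|x (i + (n + 1))| * t ^ (i + (n + 1))) * t⁻¹ ^ n := by
        refine h2.tsum_le_tsum (fun i => ?_) (h3.mul_right _)
        rw [mul_assoc, inv_pow, ← div_eq_mul_inv]
        refine le_mul_of_one_le_right (abs_nonneg _) ?_
        rw [one_le_div (by positivity)]
        exact pow_le_pow_right₀ ht (by omega)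
    _ = (∑' i, |x (i + (n + 1))| * t ^ (i + (n + 1))) * t⁻¹ ^ n := tsum_mul_right
    _ ≤ _ := by
        refine mul_le_mul_of_nonneg_right ?_ (by positivity)
        rw [← hx.sum_add_tsum_nat_add (n + 1)]
        exact le_add_of_nonneg_left (Finset.sum_nonneg fun i _ => by positivity)

theorem coeff_mk_mul_mk (a b : ℕ → ℝ) (n : ℕ) :
    PowerSeries.coeff n (PowerSeries.mk a * PowerSeries.mk b) =
      ∑ j ∈ Finset.range (n + 1), a j * b (n - j) := by
  rw [PowerSeries.coeff_mul, Finset.Nat.sum_antidiagonal_eq_sum_range_succ_mk]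
  simp

theorem coeff_mk_mul_mk_one (x : ℕ → ℝ) (n : ℕ) :
    PowerSeries.coeff n (PowerSeries.mk x * PowerSeries.mk 1) =
      ∑ i ∈ Finset.range (n + 1), x i := by
  rw [coeff_mk_mul_mk]
  simp

/-- If `q` is the sequence of coefficients of `1 / Q`, then `β n = q n - q (n - 1)` is the sequence
of coefficients of the inverse of `Q / (1 - x)`, whose coefficients are the partial sums of `Q`. -/
theorem exists_inverse_of_partial_sums {Q q : ℕ → ℝ}
    (hq : ∀ n, ∑ j ∈ Finset.range (n + 1), Q j * q (n - j) = if n = 0 then 1 else 0) :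
    ∃ β : ℕ → ℝ,
      (∀ n, ∑ j ∈ Finset.range (n + 1), (∑ i ∈ Finset.range (j + 1), Q i) * β (n - j) =
        if n = 0 then 1 else 0) ∧
      (∀ n, q n = ∑ i ∈ Finset.range (n + 1), β i) ∧
      ∀ (a : ℕ → ℝ) (n : ℕ), ∑ j ∈ Finset.range (n + 1), a j * q (n - j) =
        ∑ i ∈ Finset.range (n + 1), ∑ j ∈ Finset.range (i + 1), a j * β (i - j) := by
  have hU1 : PowerSeries.mk (1 : ℕ → ℝ) * (1 - PowerSeries.X) = 1 :=
    PowerSeries.mk_one_mul_one_sub_eq_one ℝ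
  obtain ⟨β, hβ⟩ : ∃ β : ℕ → ℝ,
      PowerSeries.mk β = PowerSeries.mk q * (1 - PowerSeries.X) :=
    ⟨fun n => PowerSeries.coeff n (PowerSeries.mk q * (1 - PowerSeries.X)), by ext n; simp⟩
  have hβU : PowerSeries.mk β * PowerSeries.mk 1 = PowerSeries.mk q := by
    rw [hβ, mul_assoc, mul_comm (1 - PowerSeries.X), hU1, mul_one]
  have hQq : PowerSeries.mk Q * PowerSeries.mk q = 1 := by
    ext n; rw [coeff_mk_mul_mk, hq, PowerSeries.coeff_one]
  refine ⟨β, fun n => ?_, fun n => ?_, fun a n => ?_⟩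
  · have hS : PowerSeries.mk (fun j => ∑ i ∈ Finset.range (j + 1), Q i) =
        PowerSeries.mk Q * PowerSeries.mk 1 := by
      ext j; rw [coeff_mk_mul_mk_one, PowerSeries.coeff_mk]
    rw [← coeff_mk_mul_mk (fun j => ∑ i ∈ Finset.range (j + 1), Q i), hS, mul_assoc,
      mul_comm (PowerSeries.mk 1), hβU, hQq, PowerSeries.coeff_one]
  · rw [← coeff_mk_mul_mk_one, hβU, PowerSeries.coeff_mk]
  · have h1 : PowerSeries.mk (fun i => ∑ j ∈ Finset.range (i + 1), a j * β (i - j)) =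
        PowerSeries.mk a * PowerSeries.mk β := by
      ext i; rw [coeff_mk_mul_mk, PowerSeries.coeff_mk]
    rw [← coeff_mk_mul_mk, ← coeff_mk_mul_mk_one (fun i => ∑ j ∈ Finset.range (i + 1), _), h1,
      mul_assoc, hβU]

/-- If the partial sums of `∑ Q_n`, apart from the first one, have weighted `ℓ¹` norm less than `1`
(in particular `∑ Q_n = 0`), then the coefficients `q` of `1 / Q` and all convolutions of `q` with
weighted `ℓ¹` sequences converge exponentially fast, the former to a nonzero limit. -/
theorem exp_convergence_of_partial_sums {Q q : ℕ → ℝ} {t : ℝ} (ht : 1 ≤ t)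
    (hq : ∀ n, ∑ j ∈ Finset.range (n + 1), Q j * q (n - j) = if n = 0 then 1 else 0)
    (hQ0 : Q 0 = 1)
    (hs : Summable fun n => |∑ i ∈ Finset.range (n + 2), Q i| * t ^ (n + 1))
    (hθ : ∑' n, |∑ i ∈ Finset.range (n + 2), Q i| * t ^ (n + 1) < 1) :
    (∃ κ C : ℝ, κ ≠ 0 ∧ ∀ n, |q n - κ| ≤ C * t⁻¹ ^ n) ∧
    ∀ a : ℕ → ℝ, (Summable fun n => |a n| * t ^ n) →
      ∃ c C : ℝ, ∀ n, |∑ j ∈ Finset.range (n + 1), a j * q (n - j) - c| ≤ C * t⁻¹ ^ n := by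
  have ht0 : 0 ≤ t := by linarith
  obtain ⟨β, hSβ, hqβ, hconv⟩ := exists_inverse_of_partial_sums hq
  obtain ⟨S, hS⟩ : ∃ S : ℕ → ℝ, ∀ n, S n = ∑ i ∈ Finset.range (n + 1), Q i := ⟨_, fun _ => rfl⟩
  simp only [← hS] at hSβ
  have hS2 : ∀ n, ∑ i ∈ Finset.range (n + 2), Q i = S (n + 1) := fun n => (hS _).symm
  simp only [hS2] at hs hθ
  have hβs : Summable fun n => |β n| * t ^ n :=
    summable_inverse ht0 (by simp [hS, hQ0]) hs hθ hSβ
  have hSs : Summable fun n => |S n| * t ^ n :=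
    (summable_nat_add_iff (f := fun n => |S n| * t ^ n) 1).1 hs
  refine ⟨⟨∑' i, β i, ∑' i, |β i| * t ^ i, ?_, fun n => ?_⟩, fun a ha => ?_⟩
  · have := tsum_mul_tsum_eq_tsum_sum_range_of_summable_norm (f := S) (g := β)
      (summable_abs_of_weighted ht hSs) (summable_abs_of_weighted ht hβs)
    simp only [hSβ, tsum_ite_eq] at this
    exact right_ne_zero_of_mul_eq_one this
  · rw [hqβ]
    exact abs_partial_sum_sub_tsum_le ht hβs n
  · have hc := summable_conv ht0 ha hβs
    exact ⟨_, _, fun n => (hconv a n).symm ▸ abs_partial_sum_sub_tsum_le ht hc n⟩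

/-! ### The root of the denominator and the growth of avoidance probabilities -/

theorem pow_div_factorial_antitone {x : ℝ} (hx : 0 ≤ x) {m n : ℕ} (hxm : x ≤ m + 1) (h : m ≤ n) :
    x ^ n / n.factorial ≤ x ^ m / m.factorial := by
  induction n, h using Nat.le_induction with
  | base => exact le_rfl
  | succ n hn ih =>
    refine le_trans ?_ ih
    have hn' : (m : ℝ) ≤ n := by exact_mod_cast hn
    have : x ^ (n + 1) / (n + 1).factorial = x ^ n / n.factorial * (x / (n + 1)) := by
      rw [Nat.factorial_succ, pow_succ]; push_cast; field_simp
    rw [this]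
    refine mul_le_of_le_one_right (by positivity) ?_
    rw [div_le_one (by positivity)]
    linarith

/-- The tail of the exponential series is dominated by its first term. -/
theorem tsum_exp_tail_le {x : ℝ} (hx : 0 ≤ x) {m : ℕ} (hxm : x ≤ (m + 1) / 3) :
    ∑' i : ℕ, x ^ (i + m) / (i + m).factorial ≤ 3 / 2 * (x ^ m / m.factorial) := by
  have hterm : ∀ i : ℕ, x ^ (i + m) / (i + m).factorial ≤ x ^ m / m.factorial * (1 / 3) ^ i := by
    intro i
    induction i with
    | zero => simp
    | succ i ih =>
      have e : x ^ (i + 1 + m) / (i + 1 + m).factorial =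
          x ^ (i + m) / (i + m).factorial * (x / (i + m + 1)) := by
        rw [show i + 1 + m = (i + m) + 1 by ring, Nat.factorial_succ, pow_succ]
        push_cast; field_simp
      rw [e, pow_succ, ← mul_assoc]
      have h3 : x / (i + m + 1) ≤ 1 / 3 := by
        rw [div_le_iff₀ (by positivity)]
        have : (0 : ℝ) ≤ i := by positivity
        linarith
      exact mul_le_mul ih h3 (by positivity) (by positivity)
  have hg : Summable fun i : ℕ => x ^ m / m.factorial * (1 / 3 : ℝ) ^ i :=
    (summable_geometric_of_lt_one (by norm_num) (by norm_num)).mul_left _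
  calc _ ≤ ∑' i : ℕ, x ^ m / m.factorial * (1 / 3 : ℝ) ^ i :=
        ((summable_nat_add_iff m).2 (Real.summable_pow_div_factorial x)).tsum_le_tsum hterm hg
    _ = _ := by
        rw [tsum_mul_left, tsum_geometric_of_lt_one (by norm_num) (by norm_num)]
        ring

theorem abs_signCoeff_le (k j : ℕ) : |signCoeff k j| ≤ 1 := by
  unfold signCoeff
  split_ifs <;> simp

/-- The power series `∑ⱼ (x ^ (jk) / (jk)! - x ^ (jk + 1) / (jk + 1)!)`, the reciprocal of the
exponential generating function of the permutations without `k`-descents. -/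
noncomputable def avoidDenom (k : ℕ) (x : ℝ) : ℝ := ∑' j, signCoeff k j * (x ^ j / j.factorial)

theorem abs_signCoeff_mul_le {x : ℝ} (hx : 0 ≤ x) (k j : ℕ) :
    |signCoeff k j * (x ^ j / j.factorial)| ≤ x ^ j / j.factorial := by
  rw [abs_mul, abs_of_nonneg (show 0 ≤ x ^ j / j.factorial by positivity)]
  exact mul_le_of_le_one_left (by positivity) (abs_signCoeff_le k j)

theorem abs_avoidDenom_sub_le {k : ℕ} {x : ℝ} (hx : 0 ≤ x) {m : ℕ} (hxm : x ≤ (m + 1) / 3) :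
    |avoidDenom k x - ∑ j ∈ Finset.range m, signCoeff k j * (x ^ j / j.factorial)| ≤
      3 / 2 * (x ^ m / m.factorial) := by
  have hs : Summable fun j => |signCoeff k j * (x ^ j / j.factorial)| :=
    Summable.of_nonneg_of_le (fun _ => abs_nonneg _) (abs_signCoeff_mul_le hx k)
      (Real.summable_pow_div_factorial x)
  have hs' := (summable_nat_add_iff m).2 hs
  rw [avoidDenom, ← hs.of_abs.sum_add_tsum_nat_add m, add_sub_cancel_left]
  calc _ ≤ ∑' i, |signCoeff k (i + m) * (x ^ (i + m) / (i + m).factorial)| := by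
        simpa only [Real.norm_eq_abs] using norm_tsum_le_tsum_norm
          (f := fun i => signCoeff k (i + m) * (x ^ (i + m) / (i + m).factorial))
          (by simpa only [Real.norm_eq_abs] using hs')
    _ ≤ ∑' i : ℕ, x ^ (i + m) / (i + m).factorial :=
        hs'.tsum_le_tsum (fun i => abs_signCoeff_mul_le hx k _)
          ((summable_nat_add_iff m).2 (Real.summable_pow_div_factorial x))
    _ ≤ _ := tsum_exp_tail_le hx hxm

theorem continuousOn_avoidDenom (k : ℕ) : ContinuousOn (avoidDenom k) (Set.Icc 1 (5 / 4)) := by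
  refine continuousOn_tsum (u := fun j : ℕ => (5 / 4 : ℝ) ^ j / j.factorial)
    (fun j => by fun_prop) (Real.summable_pow_div_factorial _) fun j x hx => ?_
  rw [Real.norm_eq_abs]
  refine (abs_signCoeff_mul_le (by linarith [hx.1]) k j).trans ?_
  have h0 : 0 ≤ x := by linarith [hx.1]
  gcongr
  exact hx.2

theorem sum_signCoeff_two_blocks {k : ℕ} (hk : 2 ≤ k) (x : ℝ) :
    ∑ j ∈ Finset.range (2 * k), signCoeff k j * (x ^ j / j.factorial) =
      1 - x + (x ^ k / k.factorial - x ^ (k + 1) / (k + 1).factorial) := by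
  rw [sum_signCoeff_mul hk fun j => x ^ j / j.factorial]
  simp [Finset.sum_range_succ]
  ring

theorem sum_signCoeff_first_block {k n : ℕ} (hn : 2 ≤ n) (hnk : n ≤ k) (x : ℝ) :
    ∑ j ∈ Finset.range n, signCoeff k j * (x ^ j / j.factorial) = 1 - x := by
  obtain ⟨m, rfl⟩ : ∃ m, n = m + 2 := ⟨n - 2, by omega⟩
  rw [Finset.sum_range_succ', Finset.sum_range_succ', Finset.sum_eq_zero]
  · simp [signCoeff, Nat.mod_eq_of_lt (show 1 < k by omega)]
    ring
  · intro j hj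
    rw [Finset.mem_range] at hj
    simp [signCoeff, Nat.mod_eq_of_lt (show j + 1 + 1 < k by omega)]

theorem exists_avoidDenom_root {k : ℕ} (hk : 3 ≤ k) :
    ∃ L ∈ Set.Icc (1 : ℝ) (5 / 4), avoidDenom k L = 0 := by
  have hk' : (3 : ℝ) ≤ k := by exact_mod_cast hk
  have hone : 0 ≤ avoidDenom k 1 := by
    have h := (abs_le.1 (abs_avoidDenom_sub_le (k := k) (x := 1) zero_le_one (m := 2 * k)
      (by push_cast; linarith))).1
    rw [sum_signCoeff_two_blocks (by omega)] at h
    simp only [one_pow] at h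
    have h2 : (1 : ℝ) / (2 * k).factorial ≤ 1 / (k + 2).factorial := by
      gcongr; omega
    have e1 : (1 : ℝ) / k.factorial = (k + 1) * (k + 2) / (k + 2).factorial := by
      rw [Nat.factorial_succ, Nat.factorial_succ]; push_cast; field_simp; ring
    have e2 : (1 : ℝ) / (k + 1).factorial = (k + 2) / (k + 2).factorial := by
      rw [Nat.factorial_succ (k + 1)]; push_cast; field_simp; ring
    have h3 : 0 ≤ ((k + 1) * (k + 2) - (k + 2) - 3 / 2 : ℝ) / (k + 2).factorial := by
      apply div_nonneg _ (by positivity)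
      nlinarith
    have e3 : ((k + 1) * (k + 2) - (k + 2) - 3 / 2 : ℝ) / (k + 2).factorial =
      1 / k.factorial - 1 / (k + 1).factorial - 3 / 2 * (1 / (k + 2).factorial) := by
      rw [e1, e2]; ring
    linarith
  have hfive : avoidDenom k (5 / 4) ≤ 0 := by
    have h := (abs_le.1 (abs_avoidDenom_sub_le (k := k) (x := 5 / 4) (by norm_num) (m := 2 * k)
      (by push_cast; linarith))).2
    rw [sum_signCoeff_two_blocks (by omega)] at h
    have h6 := pow_div_factorial_antitone (x := 5 / 4) (by norm_num) (m := 6) (n := 2 * k)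
      (by norm_num) (by omega)
    norm_num [Nat.factorial] at h6
    rcases Nat.eq_or_lt_of_le hk with rfl | hk4
    · norm_num [Nat.factorial] at h ⊢
      linarith
    · have h4 := pow_div_factorial_antitone (x := 5 / 4) (by norm_num) (m := 4) (n := k)
        (by norm_num) (by omega)
      norm_num [Nat.factorial] at h4
      have h5 : (0 : ℝ) ≤ (5 / 4) ^ (k + 1) / (k + 1).factorial := by positivity
      linarith
  obtain ⟨L, hL, h⟩ := intermediate_value_Icc' (by norm_num) (continuousOn_avoidDenom k)
    (Set.mem_Icc.2 ⟨hfive, hone⟩)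
  exact ⟨L, hL, h⟩

/-- The numerical estimate behind the simplicity and minimality of the root `L`: the nonconstant
coefficients of `avoidDenom k (L x) / (1 - x)` have total weight less than `1`, with a margin that
allows the weights `(26 / 25) ^ n`. -/
theorem weighted_partial_sums_lt_one {k : ℕ} (hk : 3 ≤ k) {L : ℝ} (hL : L ∈ Set.Icc (1 : ℝ) (5 / 4))
    (hroot : avoidDenom k L = 0) :
    (Summable fun n => |∑ i ∈ Finset.range (n + 2), signCoeff k i * (L ^ i / i.factorial)| *
      (26 / 25 : ℝ) ^ (n + 1)) ∧
    ∑' n, |∑ i ∈ Finset.range (n + 2), signCoeff k i * (L ^ i / i.factorial)| *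
      (26 / 25 : ℝ) ^ (n + 1) < 1 := by
  obtain ⟨hL1, hL2⟩ := hL
  have hL0 : 0 ≤ L := by linarith
  have hk' : (3 : ℝ) ≤ k := by exact_mod_cast hk
  set t : ℝ := 26 / 25 with ht
  set y : ℝ := L * t with hy
  have hy0 : 0 ≤ y := by positivity
  have hy1 : y ≤ 13 / 10 := by rw [hy, ht]; linarith
  set f : ℕ → ℝ := fun n => |∑ i ∈ Finset.range (n + 2), signCoeff k i * (L ^ i / i.factorial)| *
      t ^ (n + 1) with hf
  have htail : ∀ m : ℕ, 3 ≤ m →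
      |∑ i ∈ Finset.range m, signCoeff k i * (L ^ i / i.factorial)| ≤
        3 / 2 * (L ^ m / m.factorial) := by
    intro m hm
    have hm' : (3 : ℝ) ≤ m := by exact_mod_cast hm
    have := abs_avoidDenom_sub_le (k := k) hL0 (m := m) (by linarith)
    rwa [hroot, zero_sub, abs_neg] at this
  have hscale : ∀ m : ℕ, L ^ m / m.factorial * t ^ m = y ^ m / m.factorial := by
    intro m
    rw [hy, mul_pow]; ring
  have ht1 : 1 ≤ t := by norm_num [ht]
  have hbig : ∀ i, f (i + (k - 1)) ≤ 3 / 2 * (y ^ (i + (k + 1)) / (i + (k + 1)).factorial) := by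
    intro i
    have e : i + (k - 1) + 2 = i + (k + 1) := by omega
    have h1 := htail (i + (k + 1)) (by omega)
    simp only [hf, e]
    rw [← hscale, ← mul_assoc]
    refine mul_le_mul h1 (pow_le_pow_right₀ ht1 (by omega)) (by positivity) (by positivity)
  have hysum := ((summable_nat_add_iff (k + 1)).2 (Real.summable_pow_div_factorial y)).mul_left
    (3 / 2)
  have hf0 : ∀ i, 0 ≤ f i := fun i => by positivity
  have hfs' : Summable fun i => f (i + (k - 1)) := 
    Summable.of_nonneg_of_le (fun i => hf0 _) hbig hysum
  have hfs : Summable f := (summable_nat_add_iff (k - 1)).1 hfs'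
  refine ⟨hfs, ?_⟩
  have hy4 : y ^ 4 / (4 : ℕ).factorial ≤ (13 / 10) ^ 4 / (4 : ℕ).factorial := by gcongr
  have hy3 : y ^ 3 / (3 : ℕ).factorial ≤ (13 / 10) ^ 3 / (3 : ℕ).factorial := by gcongr
  norm_num [Nat.factorial] at hy4 hy3
  have hsecond : ∑' i, f (i + (k - 1)) ≤ 27 / 100 := by
    calc _ ≤ ∑' i, 3 / 2 * (y ^ (i + (k + 1)) / (i + (k + 1)).factorial) :=
          hfs'.tsum_le_tsum hbig hysum
      _ ≤ 3 / 2 * (3 / 2 * (y ^ (k + 1) / (k + 1).factorial)) := by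
          rw [tsum_mul_left]
          have := tsum_exp_tail_le hy0 (m := k + 1) (by push_cast; linarith)
          linarith
      _ ≤ 3 / 2 * (3 / 2 * (y ^ 4 / (4 : ℕ).factorial)) := by
          have := pow_div_factorial_antitone hy0 (m := 4) (n := k + 1) (by norm_num; linarith)
            (by omega)
          linarith
      _ ≤ _ := by norm_num [Nat.factorial]; linarith
  have hval : ∀ n ∈ Finset.range (k - 1), f n = (L - 1) * t ^ (n + 1) := by
    intro n hn
    rw [Finset.mem_range] at hn
    simp only [hf]
    rw [sum_signCoeff_first_block (by omega) (by omega), abs_sub_comm, abs_of_nonneg (by linarith)]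
  have hfirst : ∑ n ∈ Finset.range (k - 1), f n ≤ 72 / 100 := by
    rw [Finset.sum_congr rfl hval]
    rcases Nat.eq_or_lt_of_le hk with rfl | hk4
    · norm_num [Finset.sum_range_succ, ht]
      linarith
    · have hLk : L - 1 ≤ 3 / 2 * (L ^ k / k.factorial) := by
        have := htail k hk
        rw [sum_signCoeff_first_block (by omega) le_rfl, abs_sub_comm] at this
        exact (le_abs_self _).trans this
      calc ∑ n ∈ Finset.range (k - 1), (L - 1) * t ^ (n + 1)
          ≤ ∑ n ∈ Finset.range (k - 1), 3 / 2 * (y ^ k / k.factorial) := by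
            refine Finset.sum_le_sum fun n hn => ?_
            rw [Finset.mem_range] at hn
            rw [← hscale, ← mul_assoc]
            exact mul_le_mul hLk (pow_le_pow_right₀ ht1 (by omega)) (by positivity) (by positivity)
        _ ≤ 3 / 2 * (y * (y ^ (k - 1) / (k - 1).factorial)) := by
            obtain ⟨m, rfl⟩ : ∃ m, k = m + 1 := ⟨k - 1, by omega⟩
            rw [Finset.sum_const, Finset.card_range, nsmul_eq_mul, Nat.add_sub_cancel,
              Nat.factorial_succ]
            have e : (m : ℝ) * (3 / 2 * (y ^ (m + 1) / ((m + 1) * m.factorial : ℕ))) =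
                3 / 2 * (y * (y ^ m / m.factorial)) * (m / (m + 1)) := by
              rw [pow_succ]; push_cast; field_simp
            rw [e]
            refine mul_le_of_le_one_right (by positivity) ?_
            rw [div_le_one (by positivity)]
            linarith
        _ ≤ 3 / 2 * (13 / 10 * (y ^ 3 / (3 : ℕ).factorial)) := by
            have := pow_div_factorial_antitone hy0 (m := 3) (n := k - 1) (by norm_num; linarith)
              (by omega)
            gcongr
        _ ≤ _ := by norm_num [Nat.factorial]; linarith
  rw [← hfs.sum_add_tsum_nat_add (k - 1)]
  linarith

/-- Avoidance probabilities decay exponentially with a unique rate `1 / L`, and so do all their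
convolutions with sequences bounded by `1 / j!`. -/
theorem exists_exp_asymptotics {k : ℕ} (hk : 3 ≤ k) : ∃ L t : ℝ, 0 < L ∧ 1 < t ∧
    (∃ κ C : ℝ, κ ≠ 0 ∧ ∀ n, |avoidProb k n * L ^ n - κ| ≤ C * t⁻¹ ^ n) ∧
    ∀ a : ℕ → ℝ, (∀ j, |a j| ≤ 1 / j.factorial) → ∃ c C : ℝ, ∀ n,
      |(∑ j ∈ Finset.range (n + 1), a j * avoidProb k (n - j)) * L ^ n - c| ≤ C * t⁻¹ ^ n := by
  obtain ⟨L, hL, hroot⟩ := exists_avoidDenom_root hk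
  have hL0 : 0 < L := by linarith [hL.1]
  obtain ⟨hs, hθ⟩ := weighted_partial_sums_lt_one hk hL hroot
  have hscale : ∀ (b : ℕ → ℝ) n, ∑ j ∈ Finset.range (n + 1), b j * L ^ j *
      (avoidProb k (n - j) * L ^ (n - j)) =
      (∑ j ∈ Finset.range (n + 1), b j * avoidProb k (n - j)) * L ^ n := by
    intro b n
    rw [Finset.sum_mul]
    refine Finset.sum_congr rfl fun j hj => ?_
    rw [Finset.mem_range] at hj
    have : n = j + (n - j) := by omega
    conv_rhs => rw [this, pow_add]
    simp only [Nat.add_sub_cancel_left]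
    ring
  obtain ⟨h1, h2⟩ := exp_convergence_of_partial_sums
    (Q := fun j => signCoeff k j * (L ^ j / j.factorial)) (q := fun n => avoidProb k n * L ^ n)
    (t := 26 / 25) (by norm_num) (fun n => by
      have h := hscale (fun j => signCoeff k j / j.factorial) n
      rw [sum_signCoeff_avoidProb (by omega)] at h
      have e : (if n = 0 then (1 : ℝ) else 0) * L ^ n = if n = 0 then 1 else 0 := by
        split_ifs with h
        · simp [h]
        · simp
      rw [e] at h
      rw [← h]
      exact Finset.sum_congr rfl fun j _ => by ring) (by simp [signCoeff]) hs hθ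
  refine ⟨L, 26 / 25, hL0, by norm_num, h1, fun a ha => ?_⟩
  obtain ⟨c, C, h⟩ := h2 (fun j => a j * L ^ j) (by
    refine Summable.of_nonneg_of_le (fun j => mul_nonneg (abs_nonneg _) (by positivity))
      (fun j => ?_)
      (Real.summable_pow_div_factorial (L * (26 / 25)))
    have hpow : 0 ≤ (L * (26 / 25)) ^ j := by positivity
    calc |a j * L ^ j| * (26 / 25) ^ j = |a j| * (L * (26 / 25)) ^ j := by
          rw [abs_mul, abs_of_pos (pow_pos hL0 j), mul_assoc, ← mul_pow]
      _ ≤ 1 / j.factorial * (L * (26 / 25)) ^ j := mul_le_mul_of_nonneg_right (ha j) hpow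
      _ = (L * (26 / 25)) ^ j / j.factorial := one_div_mul_eq_div _ _)
  refine ⟨c, C, fun n => ?_⟩
  rw [← hscale]
  exact h n

/-! ### Comparison with avoiding permutations -/

/-- The set of starting points of `k`-descents of a permutation with descent set `S` is `I`. -/
def RunStartsEq (k : ℕ) (I : Finset ℕ) (S : Finset ℕ) : Prop :=
  ∀ s, 1 ≤ s → (HasRun k S s ↔ s ∈ I)

/-- A permutation of length `N` can be prolonged without new descents. -/
theorem exists_perm_descSet_eq {N T : ℕ} (hN : 1 ≤ N) (hT : N ≤ T) (w : Equiv.Perm (Fin N)) :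
    ∃ ρ : Equiv.Perm (Fin T), descSet ρ = descSet w := by
  obtain ⟨m, rfl⟩ : ∃ m, T = N + m := ⟨T - N, by omega⟩
  refine ⟨(finSumFinEquiv.symm.trans (Equiv.sumCongr w 1)).trans finSumFinEquiv, ?_⟩
  set ρ : Equiv.Perm (Fin (N + m)) :=
    (finSumFinEquiv.symm.trans (Equiv.sumCongr w 1)).trans finSumFinEquiv with hρ
  have h1 : ∀ i : Fin N, ρ (Fin.castAdd m i) = Fin.castAdd m (w i) := by
    intro i; simp [hρ]
  have h2 : ∀ i : Fin m, ρ (Fin.natAdd N i) = Fin.natAdd N i := by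
    intro i; simp [hρ]
  have h3 : descSet (ρ ∘ Fin.castAdd m) = descSet w :=
    descSet_congr fun i j => by
      simp only [Function.comp, h1, Fin.lt_def, Fin.val_castAdd]
  ext i
  rw [← h3, descSet_castAdd]
  refine ⟨fun h => ⟨?_, h⟩, fun h => h.2⟩
  by_contra hi
  obtain ⟨hi', h⟩ := mem_descSet.1 h
  obtain ⟨j, hj, rfl⟩ : ∃ j, ∃ _ : j < m, i = N + j := ⟨i - N, by omega, by omega⟩
  have hlt := h ⟨N + j - 1, by omega⟩ (Fin.natAdd N ⟨j, hj⟩) rfl (by simp; omega)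
  rw [h2, Fin.lt_def] at hlt
  rcases Nat.eq_zero_or_pos j with rfl | hj'
  · have e : (⟨N + 0 - 1, by omega⟩ : Fin (N + m)) = Fin.castAdd m ⟨N - 1, by omega⟩ := by
      ext; simp
    rw [e, h1] at hlt
    simp at hlt
    omega
  · have e : (⟨N + j - 1, by omega⟩ : Fin (N + m)) = Fin.natAdd N ⟨j - 1, by omega⟩ := by
      ext; simp; omega
    rw [e, h2] at hlt
    simp at hlt
    omega

/-- If `I` is the set of starting points of `k`-descents for some permutation of length `N`, then the
number of such permutations of length `n` is at least a constant times the number of permutations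
without `k`-descents. An avoiding permutation has an ascent at some
position `T + 1` with `N + 1 ≤ T < N + k`; its first `T` entries can be rearranged into a
prolongation of the given permutation, and `3 ≤ k` ensures that no `k`-descent is created around
`T`. -/
theorem avoidProb_le_mul {k : ℕ} (hk : 3 ≤ k) {I : Finset ℕ} {N : ℕ} (hN : 1 ≤ N)
    (w₀ : Equiv.Perm (Fin N)) (hw₀ : RunStartsEq k I (descSet w₀)) :
    ∃ C : ℝ, ∀ n, N + k ≤ n → avoidProb k n ≤ C * descProb n (RunStartsEq k I) := by
  classical
  -- `G` describes the part of the permutation after the first `T` entries.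
  set G : Finset ℕ → Prop := fun S => 1 ∉ S ∧ AvoidsAfter k 1 S with hG
  have hterm : ∀ n T, N + 1 ≤ T → T < N + k → N + k ≤ n →
      descProb n (fun S => AvoidsAfter k 0 S ∧ T + 1 ∉ S) ≤
        T.factorial * descProb n (RunStartsEq k I) := by
    intro n T hT1 hT2 hn
    obtain ⟨L, rfl⟩ : ∃ L, n = T + L := ⟨n - T, by omega⟩
    have hA : descProb (T + L) (fun S => AvoidsAfter k 0 S ∧ T + 1 ∉ S) ≤ descProb L G := by
      rw [← one_mul (descProb L G), ← descProb_true T,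
        ← descProb_split T L (fun _ => True) G (fun S => T + 1 ∉ S ∧
          ∀ s, 1 < s → ¬ HasRun k S (T + s))]
      · exact descProb_mono fun w hw => ⟨hw.2, fun s hs => hw.1 _ (by omega)⟩
      · intro w
        rw [true_and, hG]
        simp only
        rw [descSet_natAdd _ le_rfl]
        exact and_congr_right fun _ => forall_congr' fun s => forall_congr' fun hs =>
          not_congr (hasRun_natAdd _ (by omega)).symm
    obtain ⟨ρ, hρ⟩ := exists_perm_descSet_eq hN (show N ≤ T by omega) w₀
    have hF : 1 / (T.factorial : ℝ) ≤ descProb T (fun S => S = descSet w₀) := by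
      rw [descProb]
      gcongr
      rw [Nat.one_le_cast, Nat.one_le_iff_ne_zero, Finset.card_ne_zero]
      exact ⟨ρ, by simp [hρ]⟩
    have hB : descProb T (fun S => S = descSet w₀) * descProb L G ≤
        descProb (T + L) (RunStartsEq k I) := by
      rw [← descProb_split T L (fun S => S = descSet w₀) G (fun S => (∀ i < T, i ∈ S ↔
        i ∈ descSet w₀) ∧ T + 1 ∉ S ∧ ∀ s, 1 < s → ¬ HasRun k S (T + s))]
      · refine descProb_mono fun w hw s hs => ?_
        obtain ⟨h1, h2, h3⟩ := hw
        rw [← hw₀ s hs]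
        have hlt : ∀ i ∈ descSet w₀, i < N := fun i hi => (mem_descSet.1 hi).1
        constructor
        · intro hR
          by_cases hsT : T + 1 < s
          · refine absurd ?_ (h3 (s - T) (by omega))
            rwa [Nat.add_sub_cancel' (by omega)]
          by_cases hsT' : T + 2 < s + k
          · exact absurd (hR (T + 1) (by omega) (by omega)) h2
          -- The run ends at `T` or before; if it reached `N`, it would contain an ascent.
          by_cases hsN : N + 1 < s + k
          · have hm : max s N ∈ descSet w := hR _ (le_max_left _ _) (by omega)
            have hm' := hlt _ ((h1 _ (by omega)).1 hm)
            omega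
          · exact fun i hi hi' => (h1 i (by omega)).1 (hR i hi hi')
        · intro hR i hi hi'
          have := hR i hi hi'
          exact (h1 i (by have := hlt i this; omega)).2 this
      · intro w
        refine and_congr ?_ ?_
        · constructor
          · intro h
            ext i
            rw [descSet_castAdd]
            constructor
            · exact fun hi => (h i hi.1).1 hi.2
            · intro hi
              have : i < T := by have := (mem_descSet.1 hi).1; omega
              exact ⟨this, (h i this).2 hi⟩
          · intro h i hi
            rw [← h, descSet_castAdd]
            simp [hi]
        · rw [hG]
          simp only
          rw [descSet_natAdd _ le_rfl]
          exact and_congr_right fun _ => forall_congr' fun s => forall_congr' fun hs =>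
            not_congr (hasRun_natAdd _ (by omega)).symm
    have hG0 := descProb_nonneg L G
    calc _ ≤ descProb L G := hA
      _ = T.factorial * (1 / T.factorial * descProb L G) := by
          field_simp
      _ ≤ T.factorial * (descProb T (fun S => S = descSet w₀) * descProb L G) := by gcongr
      _ ≤ _ := by gcongr
  refine ⟨∑ T ∈ Finset.Ico (N + 1) (N + k), (T.factorial : ℝ), fun n hn => ?_⟩
  rw [Finset.sum_mul]
  refine le_trans ?_ (Finset.sum_le_sum fun T hT => hterm n T (Finset.mem_Ico.1 hT).1
    (Finset.mem_Ico.1 hT).2 hn)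
  simp only [avoidProb, descProb, ← Finset.sum_div]
  gcongr
  norm_cast
  refine le_trans (Finset.card_le_card ?_) Finset.card_biUnion_le
  intro w hw
  simp only [Finset.mem_filter, Finset.mem_univ, true_and, Finset.mem_biUnion] at hw ⊢
  have := hw (N + 2) (by omega)
  simp only [HasRun, not_forall] at this
  obtain ⟨i, hi1, hi2, hi⟩ := this
  refine ⟨i - 1, Finset.mem_Ico.2 ⟨by omega, by omega⟩, hw, ?_⟩
  rwa [Nat.sub_add_cancel (by omega)]

/-- For nonempty `I` the condition that `I` is the set of starting points of `k`-descents splits at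
`N = max I + k - 1` as required by the recurrence: a `k`-descent starts at `max I` but not at
`max I + 1`, which forces an ascent after the first `N` entries, and this ascent rules out the
starting points from `max I + 1` to `N`. -/
theorem exists_runStartsEq_split {k : ℕ} (hk : 2 ≤ k) {I : Finset ℕ} (hI : ∀ i ∈ I, 1 ≤ i)
    (hne : I.Nonempty) : ∃ (N : ℕ) (P : Finset ℕ → Prop),
      (∀ S S' : Finset ℕ, (∀ i < N, i ∈ S ↔ i ∈ S') → (P S ↔ P S')) ∧
      ∀ S, RunStartsEq k I S ↔ P S ∧ AvoidsAfter k N S ∧ N ∉ S := by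
  set m := I.max' hne with hm
  have hmI : m ∈ I := I.max'_mem hne
  have hle : ∀ s ∈ I, s ≤ m := fun s hs => I.le_max' s hs
  have hm1 := hI m hmI
  refine ⟨m + k - 1, fun S => ∀ s, 1 ≤ s → s ≤ m → (HasRun k S s ↔ s ∈ I), ?_, fun S => ?_⟩
  · intro S S' h
    refine forall_congr' fun s => forall_congr' fun _ => forall_congr' fun hs => ?_
    refine iff_congr (forall_congr' fun i => forall_congr' fun _ => forall_congr' fun hi => ?_)
      Iff.rfl
    exact h i (by omega)
  · constructor
    · intro h
      refine ⟨fun s hs _ => h s hs, fun s hs hR => ?_, fun hN => ?_⟩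
      · have := hle s ((h s (by omega)).1 hR)
        omega
      · have hmR := (h m hm1).2 hmI
        have := hle (m + 1) ((h (m + 1) (by omega)).1 fun i hi hi' => ?_)
        · omega
        · by_cases e : i = m + k - 1
          · exact e ▸ hN
          · exact hmR i (by omega) (by omega)
    · rintro ⟨h1, h2, h3⟩ s hs
      by_cases hsm : s ≤ m
      · exact h1 s hs hsm
      · refine ⟨fun hR => ?_, fun h => absurd (hle s h) hsm⟩
        by_cases hsN : m + k - 1 < s
        · exact absurd hR (h2 s hsN)
        · exact absurd (hR _ (by omega) (by omega)) h3

/-! ### Asymptotics of the ratio -/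

/-- Exponentially fast convergence of two sequences `u`, `v`, the latter to a nonzero limit, and
domination of `v` by `u` give `u n = c * v n * (1 + O(n ^ (-p)))` with `c ≠ 0`. -/
theorem exists_ratio_asymptotics {u v : ℕ → ℝ} {t c κ C₁ C₂ C p : ℝ} {n₀ : ℕ} (ht : 1 < t)
    (hκ : κ ≠ 0) (hu : ∀ n, n₀ ≤ n → |u n - c| ≤ C₁ * t⁻¹ ^ n)
    (hv : ∀ n, |v n - κ| ≤ C₂ * t⁻¹ ^ n) (hpos : ∀ n, 0 < v n)
    (hdom : ∀ n, n₀ ≤ n → v n ≤ C * u n) :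
    ∃ d : ℝ, ∃ ε : ℕ → ℝ,
      Asymptotics.IsBigO Filter.atTop ε (fun n : ℕ => (n : ℝ) ^ p) ∧
      ∀ n, u n = d * v n * (1 + ε n) := by
  have ht0 : 0 < t := by linarith
  have ht1 : t⁻¹ < 1 := inv_lt_one_of_one_lt₀ ht
  have hlim : ∀ K : ℝ, Filter.Tendsto (fun n : ℕ => K * t⁻¹ ^ n) Filter.atTop (nhds 0) := by
    intro K
    simpa using (tendsto_pow_atTop_nhds_zero_of_lt_one (by positivity) ht1).const_mul K
  have hvl : Filter.Tendsto v Filter.atTop (nhds κ) := by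
    rw [tendsto_iff_norm_sub_tendsto_zero]
    exact squeeze_zero (fun _ => norm_nonneg _) hv (hlim C₂)
  have hul : Filter.Tendsto u Filter.atTop (nhds c) := by
    rw [tendsto_iff_norm_sub_tendsto_zero]
    exact squeeze_zero' (Filter.Eventually.of_forall fun _ => norm_nonneg _)
      ((Filter.eventually_ge_atTop n₀).mono hu) (hlim C₁)
  have hc : c ≠ 0 := by
    rintro rfl
    have h1 : κ ≤ C * 0 := le_of_tendsto_of_tendsto hvl (hul.const_mul C)
      ((Filter.eventually_ge_atTop n₀).mono hdom)
    have h2 : 0 ≤ κ := ge_of_tendsto' hvl fun n => (hpos n).le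
    exact hκ (le_antisymm (by simpa using h1) h2)
  refine ⟨c / κ, fun n => u n / (c / κ * v n) - 1, ?_, fun n => ?_⟩
  · have hexp : (fun n : ℕ => t⁻¹ ^ n) =O[Filter.atTop] fun n : ℕ => (n : ℝ) ^ p := by
      have h := (isLittleO_exp_neg_mul_rpow_atTop (Real.log_pos ht) p).isBigO.comp_tendsto
        tendsto_natCast_atTop_atTop
      refine h.congr_left fun n => ?_
      simp only [Function.comp]
      rw [neg_mul, mul_comm, Real.exp_neg, Real.exp_nat_mul, Real.exp_log ht0, inv_pow]
    refine Asymptotics.IsBigO.trans ?_ hexp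
    have hfac : (fun n => κ / (c * v n)) =O[Filter.atTop] fun _ => (1 : ℝ) :=
      ((tendsto_const_nhds (x := κ)).div (hvl.const_mul c) (mul_ne_zero hc hκ)).isBigO_one ℝ
    have hnum : (fun n => (u n - c) - c / κ * (v n - κ)) =O[Filter.atTop] fun n : ℕ => t⁻¹ ^ n := by
      refine Asymptotics.IsBigO.sub ?_ (Asymptotics.IsBigO.const_mul_left ?_ _)
      · refine Asymptotics.IsBigO.of_bound C₁ ((Filter.eventually_ge_atTop n₀).mono fun n hn => ?_)
        rw [Real.norm_eq_abs, Real.norm_of_nonneg (by positivity)]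
        exact hu n hn
      · refine Asymptotics.IsBigO.of_bound C₂ (Filter.Eventually.of_forall fun n => ?_)
        rw [Real.norm_eq_abs, Real.norm_of_nonneg (by positivity)]
        exact hv n
    have := hfac.mul hnum
    simp only [one_mul] at this
    refine this.congr_left fun n => ?_
    have := (hpos n).ne'
    field_simp
    ring
  · have := (hpos n).ne'
    field_simp
    ring

theorem theorem5p1 (k : ℕ) (hk : 3 ≤ k) (I : Finset ℕ) (hI : ∀ i ∈ I, 1 ≤ i) :
    ∃ (c : ℝ) (ε : ℕ → ℝ),
      Asymptotics.IsBigO Filter.atTop ε (fun n : ℕ => (n : ℝ) ^ (-0.49 : ℝ)) ∧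
      ∀ n : ℕ, 1 ≤ n →
        (kDescentFun k I n : ℝ) = c * (kDescentAvoiding k n : ℝ) * (1 + ε n) := by
  have hk2 : 2 ≤ k := by omega
  rcases I.eq_empty_or_nonempty with rfl | hne
  · exact ⟨1, fun _ => 0, Asymptotics.isBigO_zero _ _, fun n _ => by simp [kDescentAvoiding]⟩
  by_cases hex : ∃ n, 1 ≤ n ∧ kDescentFun k I n ≠ 0
  swap
  · push Not at hex
    exact ⟨0, fun _ => 0, Asymptotics.isBigO_zero _ _, fun n hn => by simp [hex n hn]⟩
  obtain ⟨N₀, hN₀, h0⟩ := hex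
  obtain ⟨w₀, hw₀⟩ : ∃ w₀ : Equiv.Perm (Fin N₀), RunStartsEq k I (descSet w₀) := by
    rw [kDescentFun, Finset.card_ne_zero] at h0
    obtain ⟨w, hw⟩ := h0
    exact ⟨w, (kDescentSet_eq_iff hk2 w hI).1 (Finset.mem_filter.1 hw).2⟩
  obtain ⟨C, hC⟩ := avoidProb_le_mul hk hN₀ w₀ hw₀
  obtain ⟨N, P, hP, hsplit⟩ := exists_runStartsEq_split hk2 hI hne
  obtain ⟨L, t, hL, ht, ⟨κ, C₂, hκ, hv⟩, hconv⟩ := exists_exp_asymptotics hk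
  obtain ⟨c, C₁, hc⟩ := hconv (fun j => signCoeff k j * runProb P N j) fun j => by
    rw [abs_mul, abs_of_nonneg (runProb_nonneg P N j)]
    exact (mul_le_of_le_one_left (runProb_nonneg P N j) (abs_signCoeff_le k j)).trans
      (runProb_le P N j)
  obtain ⟨d, ε, hε, h⟩ := exists_ratio_asymptotics (p := -0.49)
    (u := fun n => descProb n (RunStartsEq k I) * L ^ n) (v := fun n => avoidProb k n * L ^ n)
    -- The factors account for the shift by `N` in the recurrence.
    (c := c * L ^ N) (C₁ := C₁ * L ^ N * t ^ N) (C := C) (n₀ := N + N₀ + k) ht hκ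
    (fun n hn => by
      obtain ⟨m, rfl⟩ : ∃ m, n = N + m := ⟨n - N, by omega⟩
      have e : descProb (N + m) (RunStartsEq k I) =
          descProb (N + m) (fun S => P S ∧ AvoidsAfter k N S ∧ N ∉ S) :=
        descProb_congr fun w => hsplit _
      have ht0 : t ≠ 0 := by linarith
      rw [e, descProb_eq_sum hk2 N P hP m]
      calc _ = |(∑ j ∈ Finset.range (m + 1), signCoeff k j * runProb P N j * avoidProb k (m - j)) *
            L ^ m - c| * L ^ N := by
            rw [← abs_of_pos (pow_pos hL N), ← abs_mul, abs_of_pos (pow_pos hL N)]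
            ring_nf
        _ ≤ C₁ * t⁻¹ ^ m * L ^ N := by
            gcongr
            exact hc m
        _ = _ := by
            rw [pow_add, inv_pow, inv_pow]
            field_simp)
    hv (fun n => mul_pos (avoidProb_pos hk2 n) (pow_pos hL n))
    (fun n hn => by
      rw [← mul_assoc]
      have := hC n (by omega)
      gcongr)
  refine ⟨d, ε, hε, fun n _ => ?_⟩
  rw [kDescentFun_eq hk2 n hI, kDescentAvoiding_eq hk2]
  have h' := h n
  have hLn : L ^ n ≠ 0 := (pow_pos hL n).ne'
  have : descProb n (RunStartsEq k I) = d * avoidProb k n * (1 + ε n) := by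
    apply mul_right_cancel₀ hLn
    linarith
  have e : descProb n (RunStartsEq k I) =
    descProb n (fun S => ∀ s, 1 ≤ s → (HasRun k S s ↔ s ∈ I)) := rfl
  rw [← e, this]
  ring
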